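/- Let $d>0$, $l>0$ and put $c_2(\rho^2)=d\cos\rho l+\frac{1-d^2\rho^2}{\rho}\sin\rho l$ for real $\rho\neq 0$. For each $n\in\mathbb N=\{1,2,\dots\}$ let $z_n$ be any zero of $\rho\mapsto c_2(\rho^2)$ in the interval $\left(\frac{\pi n}{l}-\frac{\pi}{2l},\ \frac{\pi n}{l}+\frac{\pi}{2l}\right)$ (each of these intervals contains at least one such zero). Let $W_2^2[0,l]$ be the set of functions $u:[0,l]\to\mathbb C$ such that $u$ is differentiable on $[0,l]$ (one-sidedly at the endpoints), $u$ and $u'$ are absolutely continuous on $[0,l]$, and $u''\in L_2(0,l)$; an element $f$ of $L_2(0,l)$ lies in $W_2^2[0,l]$ if it coincides almost everywhere on $(0,l)$ with such a function, whose boundary values are then written $f(l)$, $f'(0)$, $f'(l)$. Let $f\in L_2(0,l)$ be complex-valued. Then $f\in W_2^2[0,l]$ if and only if there are $v_1,v_2\in\mathbb C$ and a complex sequence $\{\tilde\gamma_k\}_{k\ge1}\in l_2$ such that $$\int_0^l f(x)\cos z_kx\,dx=\frac1{z_k^2}\Big((-1)^kv_2-v_1+\tilde\gamma_k\Big),\qquad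 k\in\mathbb N.$$ Moreover, whenever this formula holds with such $v_1,v_2,\{\tilde\gamma_k\}$, one has $v_1=f'(0)$ and $v_2=f'(l)+\dfrac{f(l)}{d}$. -/

import Mathlib

open MeasureTheory Set

namespace FrozenArg

noncomputable section

/-- The value `c₂(ρ²) = d cos(ρ l) + ((1 - d² ρ²) / ρ) sin(ρ l)` at a real `ρ ≠ 0`. -/
def c₂ (d l ρ : ℝ) : ℝ :=
  d * Real.cos (ρ * l) + (1 - d ^ 2 * ρ ^ 2) / ρ * Real.sin (ρ * l)

/-- `z 1, z 2, …` is an admissible choice of positive zeros of `ρ ↦ c₂(ρ²)`: for each `n ≥ 1`,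
`z n` is some zero in the interval `(πn/l - π/(2l), πn/l + π/(2l))`. The value `z 0` plays no
role. -/
def IsZeroChoice (d l : ℝ) (z : ℕ → ℝ) : Prop :=
  ∀ n : ℕ, 1 ≤ n →
    z n ∈ Ioo (Real.pi * n / l - Real.pi / (2 * l)) (Real.pi * n / l + Real.pi / (2 * l)) ∧
    c₂ d l (z n) = 0

/-- The derivative on the segment `[0, l]` (one-sided at the endpoints). -/
def D (l : ℝ) (u : ℝ → ℂ) : ℝ → ℂ := derivWithin u (Icc 0 l)

/-- `u` is a `W²₂[0, l]` function: `u` is differentiable on `[0, l]`, both `u` and `u'` are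
absolutely continuous on `[0, l]`, and `u'' ∈ L₂(0, l)`. -/
structure IsW22 (l : ℝ) (u : ℝ → ℂ) : Prop where
  differentiableOn : DifferentiableOn ℝ u (Icc 0 l)
  absolutelyContinuous : AbsolutelyContinuousOnInterval u 0 l
  absolutelyContinuous_deriv : AbsolutelyContinuousOnInterval (D l u) 0 l
  memLp_deriv2 : MemLp (D l (D l u)) 2 (volume.restrict (Ioo 0 l))

/-- `u` is the regular (`W²₂[0, l]`) representative of the class of `f` in `L₂(0, l)`. -/
def IsW22Rep (l : ℝ) (f u : ℝ → ℂ) : Prop :=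
  IsW22 l u ∧ f =ᵐ[volume.restrict (Ioo 0 l)] u

/-- The class of `f` in `L₂(0, l)` belongs to `W²₂[0, l]`. -/
def MemW22 (l : ℝ) (f : ℝ → ℂ) : Prop := ∃ u : ℝ → ℂ, IsW22Rep l f u

/-- The sequence `γ 1, γ 2, …` lies in `l₂` and, for all `k ≥ 1`,
`∫₀ˡ f(x) cos(z_k x) dx = z_k⁻² ((-1)ᵏ v₂ - v₁ + γ_k)`. -/
def CosAsymptotics (l : ℝ) (z : ℕ → ℝ) (f : ℝ → ℂ) (v₁ v₂ : ℂ) (γ : ℕ → ℂ) : Prop :=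
  Memℓp (fun k : ℕ => γ (k + 1)) 2 ∧
  ∀ k : ℕ, 1 ≤ k →
    ∫ x in (0 : ℝ)..l, f x * (Real.cos (z k * x) : ℂ) =
      1 / (z k : ℂ) ^ 2 * ((-1) ^ k * v₂ - v₁ + γ k)

end

end FrozenArg

/-!
If `u` is the `W²₂` representative of `f`, two integrations by parts give
`z² ∫ f cos zx = u(l) z sin zl + u'(l) cos zl - u'(0) - ∫ u'' cos zx`.
The equation `c₂ = 0` says `tan (zl) = d z / (d² z² - 1)`, so `z_k = π k / l + O(1/k)`,
`z_k sin (z_k l) = (-1)ᵏ / d + O(1/k)` and `cos (z_k l) = (-1)ᵏ + O(1/k)`; the last integral is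
square-summable because `cos z_k x` is an `O(1/k)` perturbation of `cos (π k x / l)`. This is
`IsW22Rep.exists_cosAsymptotics`. The numbers `v₁`, `v₂` are determined by the asymptotics, as is
seen along even and odd `k` (`CosAsymptotics.unique`), and this gives the formulas for them.

For the converse (`CosAsymptotics.memW22`) no basis property of the system `cos z_k x` is needed,
only the classical cosine and sine systems, by a bootstrap. Passing from the frequencies `z_k` to
`π k / l` changes the coefficients of any `L₂` function by `1/k` times a square-summable sequence
(`memℓp_mul_integral_sub`). So the cosine coefficients of `f` are `1/k` times such a sequence, and
`f` has a `W¹₂` representative `F`, `F' = g` (`exists_isW12_of_cos`). One integration by parts turns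
the hypothesis into
`z_k ∫ g sin z_k x = v₁ - (v₂ - F(l)/d) (-1)ᵏ` up to a square-summable sequence. The same change of
frequencies gives this formula for `(π k / l) ∫ g sin (π k x / l)`, and this is the behaviour of the
sine coefficients that characterizes `W¹₂` functions with boundary values `v₁` and `v₂ - F(l)/d`
(`exists_isW12_of_sin`). Hence `F' ∈ W¹₂` and `F ∈ W²₂`.
-/

namespace FrozenArg

open Filter Topology Asymptotics

/-! ### Absolutely continuous complex functions -/

theorem absolutelyContinuousOnInterval_congr {F G : ℝ → ℂ} {a b : ℝ}
    (hF : AbsolutelyContinuousOnInterval F a b) (h : EqOn F G (uIcc a b)) :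
    AbsolutelyContinuousOnInterval G a b := by
  rw [absolutelyContinuousOnInterval_iff] at hF ⊢
  intro ε hε
  obtain ⟨δ, hδ, H⟩ := hF ε hε
  refine ⟨δ, hδ, fun E hE hlen => ?_⟩
  convert H E hE hlen using 1
  refine Finset.sum_congr rfl fun i hi => ?_
  have := hE.1 i hi
  rw [h this.1, h this.2]

theorem absolutelyContinuousOnInterval_primitive {g : ℝ → ℂ} {a b : ℝ}
    (hg : IntervalIntegrable g volume a b) :
    AbsolutelyContinuousOnInterval (fun x => ∫ t in a..x, g t) a b := by
  have hre : IntervalIntegrable (fun t => (g t).re) volume a b := ⟨hg.1.re, hg.2.re⟩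
  have him : IntervalIntegrable (fun t => (g t).im) volume a b := ⟨hg.1.im, hg.2.im⟩
  have h1 := hre.absolutelyContinuousOnInterval_intervalIntegral (c := a) left_mem_uIcc
  have h2 := him.absolutelyContinuousOnInterval_intervalIntegral (c := a) left_mem_uIcc
  have hc : ∀ w : ℂ, AbsolutelyContinuousOnInterval (fun _ : ℝ => w) a b := fun w =>
    (contDiff_const.contDiffOn).absolutelyContinuousOnInterval
  refine absolutelyContinuousOnInterval_congr
    ((h1.fun_smul (hc 1)).fun_add (h2.fun_smul (hc Complex.I))) fun x hx => ?_
  have hgx : IntervalIntegrable g volume a x := hg.mono_set (uIcc_subset_uIcc_left hx)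
  have e1 := intervalIntegral.intervalIntegral_re hgx
  have e2 := intervalIntegral.intervalIntegral_im hgx
  simp only [RCLike.re_to_complex, RCLike.im_to_complex] at e1 e2
  simp only [e1, e2, Complex.real_smul, mul_one]
  exact Complex.re_add_im _

/-- The fundamental theorem of calculus for complex-valued absolutely continuous functions: the
difference of `F` and the primitive of its a.e. derivative is absolutely continuous with a.e.
vanishing derivative, hence constant. -/
theorem integral_eq_sub_of_absolutelyContinuousOnInterval {F G : ℝ → ℂ} {a b : ℝ}
    (hF : AbsolutelyContinuousOnInterval F a b)
    (hG : ∀ᵐ x, x ∈ uIcc a b → HasDerivAt F (G x) x) (hGi : IntervalIntegrable G volume a b) :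
    ∫ x in a..b, G x = F b - F a := by
  have hd : ∀ᵐ x, x ∈ uIcc a b → HasDerivAt (fun x => F x - ∫ t in a..x, G t) 0 x := by
    filter_upwards [hG, hGi.ae_hasDerivAt_integral] with x h1 h2 hx
    exact ((h1 hx).sub (h2 hx a left_mem_uIcc)).congr_deriv (sub_self _)
  obtain ⟨C, hC⟩ := (hF.fun_sub
    (absolutelyContinuousOnInterval_primitive hGi)).const_of_ae_hasDerivAt_zero hd
  have ha := hC a left_mem_uIcc
  have hb := hC b right_mem_uIcc
  simp only [intervalIntegral.integral_same, sub_zero] at ha hb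
  rw [ha, ← hb]; ring

/-- `F` is a `W¹₂[0, l]` function with weak derivative `G`: `F` is absolutely continuous on
`[0, l]` and `F' = G` almost everywhere, with `G ∈ L₂(0, l)`. -/
structure IsW12 (l : ℝ) (F G : ℝ → ℂ) : Prop where
  absolutelyContinuous : AbsolutelyContinuousOnInterval F 0 l
  ae_hasDerivAt : ∀ᵐ x, x ∈ uIcc 0 l → HasDerivAt F (G x) x
  memLp : MemLp G 2 (volume.restrict (Ioo 0 l))

theorem intervalIntegrable_of_memLp {l : ℝ} (hl : 0 < l) {g : ℝ → ℂ}
    (hg : MemLp g 2 (volume.restrict (Ioo 0 l))) : IntervalIntegrable g volume 0 l := by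
  rw [intervalIntegrable_iff_integrableOn_Ioo_of_le hl.le]
  exact hg.integrable (by norm_num)

theorem isW12_primitive {l : ℝ} (hl : 0 < l) {g : ℝ → ℂ}
    (hg : MemLp g 2 (volume.restrict (Ioo 0 l))) (C : ℂ) :
    IsW12 l (fun x => C + ∫ t in (0 : ℝ)..x, g t) g := by
  have hi := intervalIntegrable_of_memLp hl hg
  refine ⟨?_, ?_, hg⟩
  · exact ((contDiff_const.contDiffOn).absolutelyContinuousOnInterval).fun_add
      (absolutelyContinuousOnInterval_primitive hi)
  · filter_upwards [hi.ae_hasDerivAt_integral] with x hx hxl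
    exact (hx hxl 0 left_mem_uIcc).const_add C

/-- Integration by parts of a `W¹₂` function against a real `C¹` function. -/
theorem IsW12.integral_mul {l : ℝ} (hl : 0 < l) {F G : ℝ → ℂ} (h : IsW12 l F G)
    {φ φ' : ℝ → ℝ} (hφ : ∀ x, HasDerivAt φ (φ' x) x) (hφ' : Continuous φ') :
    ∫ x in (0 : ℝ)..l, G x * (φ x : ℂ) =
      F l * φ l - F 0 * φ 0 - ∫ x in (0 : ℝ)..l, F x * (φ' x : ℂ) := by
  have hcφ : Continuous φ := continuous_iff_continuousAt.2 fun x => (hφ x).continuousAt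
  have hφc : ∀ x, HasDerivAt (fun x => (φ x : ℂ)) (φ' x : ℂ) x := fun x => (hφ x).ofReal_comp
  have hACφ : AbsolutelyContinuousOnInterval (fun x => (φ x : ℂ)) 0 l := by
    refine ContDiffOn.absolutelyContinuousOnInterval (ContDiff.contDiffOn ?_)
    rw [contDiff_one_iff_deriv]
    refine ⟨fun x => (hφc x).differentiableAt, ?_⟩
    rw [show deriv (fun x => (φ x : ℂ)) = fun x => (φ' x : ℂ) from funext fun x => (hφc x).deriv]
    fun_prop
  have hGi := intervalIntegrable_of_memLp hl h.memLp
  have i1 : IntervalIntegrable (fun x => G x * (φ x : ℂ)) volume 0 l :=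
    hGi.mul_continuousOn (by fun_prop)
  have i2 : IntervalIntegrable (fun x => F x * (φ' x : ℂ)) volume 0 l :=
    (h.absolutelyContinuous.continuousOn.mul (by fun_prop)).intervalIntegrable
  have := integral_eq_sub_of_absolutelyContinuousOnInterval (F := fun x => F x * (φ x : ℂ))
    (G := fun x => G x * (φ x : ℂ) + F x * (φ' x : ℂ))
    (h.absolutelyContinuous.fun_smul hACφ)
    (by filter_upwards [h.ae_hasDerivAt] with x hx hxl using (hx hxl).mul (hφc x)) (i1.add i2)
  rw [intervalIntegral.integral_add i1 i2] at this
  rw [← this]; ring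

theorem IsW12.eq_integral {l : ℝ} (hl : 0 < l) {F G : ℝ → ℂ} (h : IsW12 l F G) {x : ℝ}
    (hx : x ∈ Icc 0 l) : F x = F 0 + ∫ t in (0 : ℝ)..x, G t := by
  have hs : uIcc 0 x ⊆ uIcc 0 l := by
    rw [uIcc_of_le hx.1, uIcc_of_le hl.le]; exact Icc_subset_Icc_right hx.2
  rw [integral_eq_sub_of_absolutelyContinuousOnInterval (h.absolutelyContinuous.mono hs)
    (by filter_upwards [h.ae_hasDerivAt] with y hy hyx using hy (hs hyx))
    ((intervalIntegrable_of_memLp hl h.memLp).mono_set hs)]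
  ring

theorem IsW12.mul_integral_cos {l : ℝ} (hl : 0 < l) {F G : ℝ → ℂ} (h : IsW12 l F G) (r : ℝ) :
    (r : ℂ) * ∫ x in (0 : ℝ)..l, F x * (Real.cos (r * x) : ℂ) =
      F l * Real.sin (r * l) - ∫ x in (0 : ℝ)..l, G x * (Real.sin (r * x) : ℂ) := by
  have := h.integral_mul hl (φ := fun x => Real.sin (r * x)) (φ' := fun x => r * Real.cos (r * x))
    (fun x => by
      have := ((hasDerivAt_id x).const_mul r).sin
      simpa [mul_comm] using this) (by fun_prop)
  rw [this, ← intervalIntegral.integral_const_mul]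
  simp only [mul_zero, Real.sin_zero, Complex.ofReal_zero, sub_zero, sub_sub_cancel]
  refine intervalIntegral.integral_congr fun x _ => ?_
  push_cast; ring

theorem IsW12.mul_integral_sin {l : ℝ} (hl : 0 < l) {F G : ℝ → ℂ} (h : IsW12 l F G) (r : ℝ) :
    (r : ℂ) * ∫ x in (0 : ℝ)..l, F x * (Real.sin (r * x) : ℂ) =
      F 0 - F l * Real.cos (r * l) + ∫ x in (0 : ℝ)..l, G x * (Real.cos (r * x) : ℂ) := by
  have := h.integral_mul hl (φ := fun x => Real.cos (r * x)) (φ' := fun x => -(r * Real.sin (r * x)))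
    (fun x => by
      have := ((hasDerivAt_id x).const_mul r).cos
      simpa [mul_comm] using this) (by fun_prop)
  rw [this, ← intervalIntegral.integral_const_mul]
  have e : ∫ x in (0 : ℝ)..l, F x * ((-(r * Real.sin (r * x)) : ℝ) : ℂ) =
      -∫ x in (0 : ℝ)..l, (r : ℂ) * (F x * (Real.sin (r * x) : ℂ)) := by
    rw [← intervalIntegral.integral_neg]
    refine intervalIntegral.integral_congr fun x _ => ?_
    push_cast; ring
  rw [e]
  simp
  ring

/-! ### The space `W²₂[0, l]` -/

theorem ae_mem_Ioo_of_mem_uIcc {l : ℝ} (hl : 0 < l) : ∀ᵐ x : ℝ, x ∈ uIcc 0 l → x ∈ Ioo 0 l := by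
  have h0 : ∀ᵐ x : ℝ, x ≠ 0 := by simp [ae_iff, measure_singleton]
  have h1 : ∀ᵐ x : ℝ, x ≠ l := by simp [ae_iff, measure_singleton]
  filter_upwards [h0, h1] with x hx0 hx1 hx
  rw [uIcc_of_le hl.le] at hx
  exact ⟨lt_of_le_of_ne hx.1 hx0.symm, lt_of_le_of_ne hx.2 hx1⟩

theorem hasDerivAt_D {l x : ℝ} {u : ℝ → ℂ} (hx : x ∈ Ioo 0 l) (hd : DifferentiableAt ℝ u x) :
    HasDerivAt u (D l u x) x := by
  rw [D, derivWithin_of_mem_nhds (Icc_mem_nhds hx.1 hx.2)]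
  exact hd.hasDerivAt

theorem IsW22.isW12_deriv {l : ℝ} (hl : 0 < l) {u : ℝ → ℂ} (h : IsW22 l u) :
    IsW12 l (D l u) (D l (D l u)) := by
  refine ⟨h.absolutelyContinuous_deriv, ?_, h.memLp_deriv2⟩
  have hd := h.absolutelyContinuous_deriv.boundedVariationOn.ae_differentiableAt_of_mem_uIcc
  filter_upwards [hd, ae_mem_Ioo_of_mem_uIcc hl] with x h1 h2 hx
  exact hasDerivAt_D (h2 hx) (h1 hx)

theorem memLp_of_continuousOn {l : ℝ} {φ : ℝ → ℂ} (h : ContinuousOn φ (Icc 0 l)) :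
    MemLp φ 2 (volume.restrict (Ioo 0 l)) := by
  obtain ⟨C, hC⟩ := isCompact_Icc.exists_bound_of_continuousOn h
  refine MemLp.of_bound ((h.mono Ioo_subset_Icc_self).aestronglyMeasurable measurableSet_Ioo) C ?_
  filter_upwards [ae_restrict_mem measurableSet_Ioo] with x hx using hC x (Ioo_subset_Icc_self hx)

theorem IsW22.isW12 {l : ℝ} (hl : 0 < l) {u : ℝ → ℂ} (h : IsW22 l u) : IsW12 l u (D l u) := by
  refine ⟨h.absolutelyContinuous, ?_, ?_⟩
  · filter_upwards [ae_mem_Ioo_of_mem_uIcc hl] with x h2 hx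
    exact hasDerivAt_D (h2 hx)
      ((h.differentiableOn x (Ioo_subset_Icc_self (h2 hx))).differentiableAt
        (Icc_mem_nhds (h2 hx).1 (h2 hx).2))
  · refine memLp_of_continuousOn ?_
    simpa [uIcc_of_le hl.le] using h.absolutelyContinuous_deriv.continuousOn

/-- A second primitive of an `L₂` function is a `W²₂` function. -/
theorem isW22_of_primitive {l : ℝ} (hl : 0 < l) {u φ q : ℝ → ℂ} (hφ : IsW12 l φ q)
    (hu : ∀ x ∈ Icc 0 l, u x = u 0 + ∫ t in (0 : ℝ)..x, φ t) : IsW22 l u := by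
  have hc : ContinuousOn φ (Icc 0 l) := by
    simpa [uIcc_of_le hl.le] using hφ.absolutelyContinuous.continuousOn
  have hφi : IntervalIntegrable φ volume 0 l :=
    (hφ.absolutelyContinuous.continuousOn).intervalIntegrable
  have hd : ∀ x ∈ Icc 0 l, HasDerivWithinAt u (φ x) (Icc 0 l) x := by
    intro x hx
    have hs : uIcc 0 x ⊆ uIcc 0 l := by
      rw [uIcc_of_le hx.1, uIcc_of_le hl.le]; exact Icc_subset_Icc_right hx.2
    have : Fact (x ∈ Icc 0 l) := ⟨hx⟩
    have := intervalIntegral.integral_hasDerivWithinAt_right (hφi.mono_set hs)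
      (s := Icc 0 l) (t := Icc 0 l)
      (hc.stronglyMeasurableAtFilter_nhdsWithin measurableSet_Icc x) (hc x hx)
    exact (this.const_add (u 0)).congr hu (hu x hx)
  have hD : ∀ x ∈ Icc 0 l, D l u x = φ x := fun x hx =>
    (hd x hx).derivWithin (uniqueDiffOn_Icc hl x hx)
  have hac : AbsolutelyContinuousOnInterval u 0 l := by
    refine absolutelyContinuousOnInterval_congr
      (isW12_primitive hl (memLp_of_continuousOn hc) (u 0)).absolutelyContinuous fun x hx => ?_
    rw [uIcc_of_le hl.le] at hx
    exact (hu x hx).symm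
  refine ⟨fun x hx => (hd x hx).differentiableWithinAt, hac, ?_, ?_⟩
  · refine absolutelyContinuousOnInterval_congr hφ.absolutelyContinuous fun x hx => ?_
    rw [uIcc_of_le hl.le] at hx
    exact (hD x hx).symm
  · refine hφ.memLp.ae_eq ?_
    rw [EventuallyEq, ae_restrict_iff' measurableSet_Ioo]
    filter_upwards [hφ.ae_hasDerivAt] with x hx hxl
    have hxI := Ioo_subset_Icc_self hxl
    have h1 := (hx (by rwa [uIcc_of_le hl.le])).hasDerivWithinAt (s := Icc 0 l)
    exact ((h1.congr hD (hD x hxI)).derivWithin (uniqueDiffOn_Icc hl x hxI)).symm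

/-! ### Cosine and sine series on `(0, l)` -/

theorem measurePreserving_neg_Ioo (a b : ℝ) :
    MeasurePreserving (fun x : ℝ => -x) (volume.restrict (Ioo (-b) (-a)))
      (volume.restrict (Ioo a b)) := by
  have h := (Measure.measurePreserving_neg (volume : Measure ℝ)).restrict_preimage
    (measurableSet_Ioo (a := a) (b := b))
  convert h using 2
  simp

/-- The extension of a function on `(0, l)` to `(-l, l)` by `h (-x) = s * h x`: the even extension
for `s = 1`, the odd one for `s = -1`. -/
noncomputable def reflect (s : ℂ) (h : ℝ → ℂ) (x : ℝ) : ℂ := if 0 < x then h x else s * h (-x)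

theorem memLp_reflect {l : ℝ} (s : ℂ) {h : ℝ → ℂ}
    (hh : MemLp h 2 (volume.restrict (Ioo 0 l))) :
    MemLp (reflect s h) 2 (volume.restrict (Ioc (-l) l)) := by
  classical
  have hneg := (hh.comp_measurePreserving (measurePreserving_neg_Ioo 0 l)).const_mul s
  rw [neg_zero] at hneg
  have : reflect s h = (Ioi (0 : ℝ)).piecewise h (fun x => s * h (-x)) := by
    ext x; by_cases hx : 0 < x <;> simp [reflect, Set.piecewise, hx]
  rw [this]
  refine MemLp.piecewise measurableSet_Ioi ?_ ?_
  · rw [Measure.restrict_restrict measurableSet_Ioi]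
    rw [restrict_Ioo_eq_restrict_Ioc] at hh
    refine hh.mono_measure (Measure.restrict_mono ?_ le_rfl)
    rintro x ⟨hx, hx'⟩
    exact ⟨hx, hx'.2⟩
  · rw [Measure.restrict_restrict measurableSet_Ioi.compl]
    rw [restrict_Ioo_eq_restrict_Ioc] at hneg
    refine MemLp.mono_measure (Measure.restrict_mono ?_ le_rfl) hneg
    rintro x ⟨hx, hx'⟩
    exact ⟨hx'.1, by simpa using hx⟩

theorem integral_reflect_mul {l : ℝ} (hl : 0 < l) (s : ℂ) {h : ℝ → ℂ}
    (hh : MemLp h 2 (volume.restrict (Ioo 0 l))) {E : ℝ → ℂ} (hE : Continuous E) :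
    ∫ x in (-l)..l, reflect s h x * E x = ∫ x in (0 : ℝ)..l, h x * (E x + s * E (-x)) := by
  have hi := intervalIntegrable_of_memLp hl hh
  have hHi : IntervalIntegrable (reflect s h) volume (-l) l := by
    rw [intervalIntegrable_iff_integrableOn_Ioc_of_le (by linarith)]
    exact (memLp_reflect s hh).integrable (by norm_num)
  have hHE : IntervalIntegrable (fun x => reflect s h x * E x) volume (-l) l :=
    hHi.mul_continuousOn hE.continuousOn
  have h0 : (0 : ℝ) ∈ uIcc (-l) l := by
    rw [uIcc_of_le (by linarith)]; constructor <;> linarith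
  rw [← intervalIntegral.integral_add_adjacent_intervals
    (hHE.mono_set (uIcc_subset_uIcc_left h0)) (hHE.mono_set (uIcc_subset_uIcc_right h0))]
  have e1 : ∫ x in (0 : ℝ)..l, reflect s h x * E x = ∫ x in (0 : ℝ)..l, h x * E x := by
    refine intervalIntegral.integral_congr_ae (Eventually.of_forall fun x hx => ?_)
    rw [uIoc_of_le hl.le] at hx
    simp [reflect, hx.1]
  have e2 : ∫ x in (-l)..0, reflect s h x * E x = ∫ x in (0 : ℝ)..l, h x * (s * E (-x)) := by
    have := intervalIntegral.integral_comp_neg (a := -l) (b := 0) (fun x => h x * (s * E (-x)))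
    rw [neg_zero, neg_neg] at this
    rw [← this]
    refine intervalIntegral.integral_congr_ae (Eventually.of_forall fun x hx => ?_)
    rw [uIoc_of_le (by linarith)] at hx
    simp only [reflect, not_lt.2 hx.2, if_false, neg_neg]
    ring
  rw [e1, e2, add_comm, ← intervalIntegral.integral_add (hi.mul_continuousOn hE.continuousOn)
    (hi.mul_continuousOn (by fun_prop))]
  simp only [mul_add]

theorem fourier_neg_coe (l : ℝ) (n : ℤ) (x : ℝ) :
    fourier (-n) (x : AddCircle (l - -l)) =
      (Real.cos (Real.pi * n / l * x) : ℂ) - Complex.I * (Real.sin (Real.pi * n / l * x) : ℂ) := by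
  rw [fourier_coe_apply]
  have : 2 * (Real.pi : ℂ) * Complex.I * ((-n : ℤ) : ℂ) * x / ((l - -l : ℝ) : ℂ) =
      ((-(Real.pi * n / l * x) : ℝ) : ℂ) * Complex.I := by
    rw [show l - -l = 2 * l by ring]
    push_cast
    rcases eq_or_ne (l : ℂ) 0 with h | h
    · simp [h]
    · field_simp
  rw [this, Complex.exp_mul_I, ← Complex.ofReal_cos, ← Complex.ofReal_sin, Real.cos_neg,
    Real.sin_neg]
  push_cast; ring

/-- The Fourier coefficients of the even extension are the cosine coefficients, those of the odd
extension are the sine coefficients. -/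
theorem fourierCoeffOn_reflect {l : ℝ} (hl : 0 < l) (s : ℂ) {h : ℝ → ℂ}
    (hh : MemLp h 2 (volume.restrict (Ioo 0 l))) (n : ℤ) :
    fourierCoeffOn (neg_lt_self hl) (reflect s h) n = (1 / (2 * l) : ℂ) *
      ((1 + s) * (∫ x in (0 : ℝ)..l, h x * (Real.cos (Real.pi * n / l * x) : ℂ)) -
        Complex.I * (1 - s) * ∫ x in (0 : ℝ)..l, h x * (Real.sin (Real.pi * n / l * x) : ℂ)) := by
  have hi := intervalIntegrable_of_memLp hl hh
  rw [fourierCoeffOn_eq_integral]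
  have e : ∀ x : ℝ, fourier (-n) (x : AddCircle (l - -l)) • reflect s h x = reflect s h x *
      ((Real.cos (Real.pi * n / l * x) : ℂ) - Complex.I * (Real.sin (Real.pi * n / l * x) : ℂ)) :=
    fun x => by rw [fourier_neg_coe, smul_eq_mul, mul_comm]
  simp_rw [e]
  rw [integral_reflect_mul hl s hh (E := fun x => (Real.cos (Real.pi * n / l * x) : ℂ) -
    Complex.I * (Real.sin (Real.pi * n / l * x) : ℂ)) (by fun_prop)]
  rw [← intervalIntegral.integral_const_mul, ← intervalIntegral.integral_const_mul,
    ← intervalIntegral.integral_sub ((hi.mul_continuousOn (by fun_prop)).const_mul _)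
      ((hi.mul_continuousOn (by fun_prop)).const_mul _)]
  rw [Complex.real_smul]
  congr 1
  · push_cast; congr 1; ring
  · refine intervalIntegral.integral_congr fun x _ => ?_
    simp only [mul_neg, Real.cos_neg, Real.sin_neg]
    push_cast; ring

theorem hasSum_sq_reflect {l : ℝ} (hl : 0 < l) (s : ℂ) {h : ℝ → ℂ}
    (hh : MemLp h 2 (volume.restrict (Ioo 0 l))) :
    HasSum (fun n => ‖fourierCoeffOn (neg_lt_self hl) (reflect s h) n‖ ^ 2)
      ((l - -l)⁻¹ • ∫ x in (-l)..l, ‖reflect s h x‖ ^ 2) :=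
  hasSum_sq_fourierCoeffOn (neg_lt_self hl) (memLp_reflect s hh)

/-- **Bessel's inequality** for the cosine system, in qualitative form. -/
theorem summable_sq_integral_cos {l : ℝ} (hl : 0 < l) {h : ℝ → ℂ}
    (hh : MemLp h 2 (volume.restrict (Ioo 0 l))) :
    Summable fun k : ℕ => ‖∫ x in (0 : ℝ)..l, h x * (Real.cos (Real.pi * k / l * x) : ℂ)‖ ^ 2 := by
  have := ((hasSum_sq_reflect hl 1 hh).summable.comp_injective
    (Nat.cast_injective (R := ℤ))).mul_left (l ^ 2)
  refine this.congr fun k => ?_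
  simp only [Function.comp, fourierCoeffOn_reflect hl 1 hh]
  rw [sub_self, mul_zero, zero_mul, sub_zero, norm_mul, norm_mul, ← mul_pow]
  congr 1
  have : ‖(1 / (2 * l) : ℂ)‖ = 1 / (2 * l) := by simp [abs_of_pos hl]
  rw [this, show ‖(1 + 1 : ℂ)‖ = 2 by norm_num, Int.cast_natCast]
  field_simp

/-- **Bessel's inequality** for the sine system, in qualitative form. -/
theorem summable_sq_integral_sin {l : ℝ} (hl : 0 < l) {h : ℝ → ℂ}
    (hh : MemLp h 2 (volume.restrict (Ioo 0 l))) :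
    Summable fun k : ℕ => ‖∫ x in (0 : ℝ)..l, h x * (Real.sin (Real.pi * k / l * x) : ℂ)‖ ^ 2 := by
  have := ((hasSum_sq_reflect hl (-1) hh).summable.comp_injective
    (Nat.cast_injective (R := ℤ))).mul_left (l ^ 2)
  refine this.congr fun k => ?_
  simp only [Function.comp, fourierCoeffOn_reflect hl (-1) hh]
  rw [add_neg_cancel, zero_mul, zero_sub, norm_mul, norm_neg, norm_mul, norm_mul, ← mul_pow]
  congr 1
  have : ‖(1 / (2 * l) : ℂ)‖ = 1 / (2 * l) := by simp [abs_of_pos hl]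
  rw [this, show ‖(1 - -1 : ℂ)‖ = 2 by norm_num, Int.cast_natCast, Complex.norm_I]
  field_simp

theorem ae_eq_zero_of_fourierCoeffOn_reflect {l : ℝ} (hl : 0 < l) (s : ℂ) {h : ℝ → ℂ}
    (hh : MemLp h 2 (volume.restrict (Ioo 0 l)))
    (h0 : ∀ n : ℤ, fourierCoeffOn (neg_lt_self hl) (reflect s h) n = 0) :
    h =ᵐ[volume.restrict (Ioo 0 l)] 0 := by
  have hs := hasSum_sq_reflect hl s hh
  simp only [h0, norm_zero, ne_eq, OfNat.ofNat_ne_zero, not_false_eq_true, zero_pow] at hs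
  have hz := hs.unique hasSum_zero
  rw [smul_eq_mul, mul_eq_zero, intervalIntegral.integral_of_le (by linarith)] at hz
  have hz := hz.resolve_left (inv_ne_zero (by linarith))
  rw [integral_eq_zero_iff_of_nonneg (fun x => by positivity)
    ((memLp_reflect s hh).integrable_norm_pow (by norm_num))] at hz
  have hz := ae_restrict_of_ae_restrict_of_subset
    (show Ioo 0 l ⊆ Ioc (-l) l from fun x hx => ⟨by linarith [hx.1], hx.2.le⟩) hz
  filter_upwards [hz, ae_restrict_mem measurableSet_Ioo] with x hx hxl
  simpa [reflect, hxl.1] using hx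

/-- Completeness of the system `cos (π k x / l)`, `k ≥ 0`, in `L₂(0, l)`: it is the completeness of
the exponentials on `(-l, l)`, applied to the even extension. -/
theorem ae_eq_zero_of_integral_cos {l : ℝ} (hl : 0 < l) {h : ℝ → ℂ}
    (hh : MemLp h 2 (volume.restrict (Ioo 0 l)))
    (h0 : ∀ k : ℕ, ∫ x in (0 : ℝ)..l, h x * (Real.cos (Real.pi * k / l * x) : ℂ) = 0) :
    h =ᵐ[volume.restrict (Ioo 0 l)] 0 := by
  refine ae_eq_zero_of_fourierCoeffOn_reflect hl 1 hh fun n => ?_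
  rw [fourierCoeffOn_reflect hl 1 hh]
  have : ∫ x in (0 : ℝ)..l, h x * (Real.cos (Real.pi * n / l * x) : ℂ) = 0 := by
    rcases Int.eq_nat_or_neg n with ⟨k, rfl | rfl⟩
    · simpa using h0 k
    · rw [← h0 k]
      refine intervalIntegral.integral_congr fun x _ => ?_
      rw [← Real.cos_neg (Real.pi * k / l * x)]
      congr 3; push_cast; ring
  rw [this]; simp

/-- Completeness of the system `sin (π k x / l)`, `k ≥ 1`, in `L₂(0, l)`, by odd extension. -/
theorem ae_eq_zero_of_integral_sin {l : ℝ} (hl : 0 < l) {h : ℝ → ℂ}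
    (hh : MemLp h 2 (volume.restrict (Ioo 0 l)))
    (h0 : ∀ k : ℕ, 1 ≤ k →
      ∫ x in (0 : ℝ)..l, h x * (Real.sin (Real.pi * k / l * x) : ℂ) = 0) :
    h =ᵐ[volume.restrict (Ioo 0 l)] 0 := by
  have h0' : ∀ k : ℕ, ∫ x in (0 : ℝ)..l, h x * (Real.sin (Real.pi * k / l * x) : ℂ) = 0 := by
    intro k
    rcases Nat.eq_zero_or_pos k with rfl | hk
    · simp
    · exact h0 k hk
  refine ae_eq_zero_of_fourierCoeffOn_reflect hl (-1) hh fun n => ?_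
  rw [fourierCoeffOn_reflect hl (-1) hh]
  have : ∫ x in (0 : ℝ)..l, h x * (Real.sin (Real.pi * n / l * x) : ℂ) = 0 := by
    rcases Int.eq_nat_or_neg n with ⟨k, rfl | rfl⟩
    · simpa using h0' k
    · rw [← neg_eq_zero, ← h0' k, ← intervalIntegral.integral_neg]
      refine intervalIntegral.integral_congr fun x _ => ?_
      rw [← mul_neg, ← Complex.ofReal_neg, ← Real.sin_neg]
      congr 3; push_cast; ring
  rw [this]; simp

/-- **Riesz–Fischer** on `(-l, l)`: every square-summable sequence consists of the Fourier
coefficients of some `L₂` function. -/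
theorem exists_memLp_fourierCoeffOn_eq {l : ℝ} (hl : 0 < l) {a : ℤ → ℂ}
    (ha : Summable fun n => ‖a n‖ ^ 2) :
    ∃ G : ℝ → ℂ, MemLp G 2 (volume.restrict (Ioc (-l) l)) ∧
      ∀ n : ℤ, fourierCoeffOn (neg_lt_self hl) G n = a n := by
  have hT : Fact (0 < l - -l) := ⟨by linarith⟩
  have hm : Memℓp a 2 := by
    rw [memℓp_gen_iff (by norm_num)]
    simpa using ha
  let A : lp (fun _ : ℤ => ℂ) 2 := ⟨a, hm⟩
  let G₀ := (fourierBasis (T := l - -l)).repr.symm A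
  have hG₀ : ∀ n, fourierCoeff G₀ n = a n := fun n => by
    rw [← fourierBasis_repr, LinearIsometryEquiv.apply_symm_apply]
  refine ⟨fun x => G₀ (x : AddCircle (l - -l)), ?_, fun n => ?_⟩
  · have h1 : MemLp G₀ 2 (volume : Measure (AddCircle (l - -l))) :=
      memLp_haarAddCircle_iff.1 (Lp.memLp G₀)
    have h2 := h1.comp_measurePreserving (AddCircle.measurePreserving_mk (l - -l) (-l))
    rwa [show -l + (l - -l) = l by ring] at h2
  · rw [← hG₀ n, fourierCoeffOn_eq_integral, fourierCoeff_eq_intervalIntegral _ _ (-l),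
      show -l + (l - -l) = l by ring]

theorem memLp_fold {l : ℝ} (hl : 0 < l) (s : ℂ) {G : ℝ → ℂ}
    (hG : MemLp G 2 (volume.restrict (Ioc (-l) l))) :
    MemLp (fun x => G x + s * G (-x)) 2 (volume.restrict (Ioo 0 l)) := by
  have hGp : MemLp G 2 (volume.restrict (Ioo 0 l)) :=
    hG.mono_measure (Measure.restrict_mono
      (show Ioo 0 l ⊆ Ioc (-l) l from fun x hx => ⟨by linarith [hx.1], hx.2.le⟩) le_rfl)
  have hGm : MemLp (fun x => G (-x)) 2 (volume.restrict (Ioo 0 l)) := by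
    have hneg := measurePreserving_neg_Ioo (-l) 0
    rw [neg_neg, neg_zero] at hneg
    exact MemLp.comp_measurePreserving (hG.mono_measure (Measure.restrict_mono
      (show Ioo (-l) 0 ⊆ Ioc (-l) l from fun x hx => ⟨hx.1, by linarith [hx.2]⟩) le_rfl)) hneg
  exact hGp.add (hGm.const_mul s)

/-- Folding `(-l, l)` onto `(0, l)` against an even (`s = 1`) or odd (`s = -1`) function. -/
theorem integral_fold_mul {l : ℝ} (hl : 0 < l) {s : ℂ} {G : ℝ → ℂ}
    (hG : MemLp G 2 (volume.restrict (Ioc (-l) l))) {E : ℝ → ℂ} (hE : Continuous E)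
    (hEs : ∀ x, E (-x) = s * E x) :
    ∫ x in (0 : ℝ)..l, (G x + s * G (-x)) * E x = ∫ x in (-l)..l, G x * E x := by
  have h0 : (0 : ℝ) ∈ uIcc (-l) l := by
    rw [uIcc_of_le (by linarith)]; constructor <;> linarith
  have hi : IntervalIntegrable G volume (-l) l := by
    rw [intervalIntegrable_iff_integrableOn_Ioc_of_le (by linarith)]
    exact hG.integrable (by norm_num)
  have hGE := hi.mul_continuousOn (g := E) hE.continuousOn
  have i1 := hGE.mono_set (uIcc_subset_uIcc_right h0)
  have i2 := hGE.mono_set (uIcc_subset_uIcc_left h0)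
  have i3 := i2.comp_sub_left 0
  simp only [zero_sub, sub_neg_eq_add, sub_zero, zero_add] at i3
  rw [← intervalIntegral.integral_add_adjacent_intervals i2 i1]
  have := intervalIntegral.integral_comp_neg (a := 0) (b := l) (fun x => G x * E x)
  rw [neg_zero] at this
  rw [← this, add_comm, ← intervalIntegral.integral_add i1 i3.symm]
  refine intervalIntegral.integral_congr fun x _ => ?_
  simp only [hEs]
  ring

/-- Riesz–Fischer on `(-l, l)` in real form, for cosine and sine coefficients at once. -/
theorem exists_memLp_integral_cos_sin_eq {l : ℝ} (hl : 0 < l) {a : ℤ → ℂ}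
    (ha : Summable fun n => ‖a n‖ ^ 2) :
    ∃ G : ℝ → ℂ, MemLp G 2 (volume.restrict (Ioc (-l) l)) ∧ ∀ k : ℕ,
      ∫ x in (-l)..l, G x * (Real.cos (Real.pi * k / l * x) : ℂ) = l * (a k + a (-k)) ∧
      ∫ x in (-l)..l, G x * (Real.sin (Real.pi * k / l * x) : ℂ) =
        Complex.I * l * (a k - a (-k)) := by
  obtain ⟨G, hG, hGa⟩ := exists_memLp_fourierCoeffOn_eq hl ha
  refine ⟨G, hG, fun k => ?_⟩
  have hi : IntervalIntegrable G volume (-l) l := by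
    rw [intervalIntegrable_iff_integrableOn_Ioc_of_le (by linarith)]
    exact hG.integrable (by norm_num)
  have key : ∀ n : ℤ, (∫ x in (-l)..l, G x * (Real.cos (Real.pi * n / l * x) : ℂ)) -
      Complex.I * (∫ x in (-l)..l, G x * (Real.sin (Real.pi * n / l * x) : ℂ)) =
      2 * l * a n := by
    intro n
    rw [← hGa n, fourierCoeffOn_eq_integral, Complex.real_smul,
      ← intervalIntegral.integral_const_mul,
      ← intervalIntegral.integral_sub (hi.mul_continuousOn (by fun_prop))
        ((hi.mul_continuousOn (by fun_prop)).const_mul _)]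
    have hl' : (l : ℂ) ≠ 0 := by exact_mod_cast hl.ne'
    have : (2 * (l : ℂ)) * ((1 / (l - -l) : ℝ) : ℂ) = 1 := by
      push_cast; rw [sub_neg_eq_add, ← two_mul]; field_simp
    rw [← mul_assoc, this, one_mul]
    refine intervalIntegral.integral_congr fun x _ => ?_
    simp only [fourier_neg_coe, smul_eq_mul]
    ring
  have h1 := key k
  have h2 := key (-k)
  have hneg : ∀ x : ℝ, Real.pi * ((-(k : ℤ) : ℤ) : ℝ) / l * x = -(Real.pi * k / l * x) := by
    intro x; push_cast; ring
  simp only [hneg, Real.cos_neg, Real.sin_neg, Complex.ofReal_neg, mul_neg,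
    intervalIntegral.integral_neg, sub_neg_eq_add, Int.cast_natCast] at h1 h2
  constructor
  · linear_combination (h1 + h2) / 2
  · linear_combination Complex.I / 2 * (h1 - h2) +
      (∫ x in (-l)..l, G x * (Real.sin (Real.pi * k / l * x) : ℂ)) * Complex.I_mul_I

/-- **Riesz–Fischer** for the cosine system. -/
theorem exists_memLp_integral_cos_eq {l : ℝ} (hl : 0 < l) {c : ℕ → ℂ}
    (hc : Summable fun k => ‖c k‖ ^ 2) :
    ∃ g : ℝ → ℂ, MemLp g 2 (volume.restrict (Ioo 0 l)) ∧
      ∀ k : ℕ, ∫ x in (0 : ℝ)..l, g x * (Real.cos (Real.pi * k / l * x) : ℂ) = c k := by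
  have hl' : (l : ℂ) ≠ 0 := by exact_mod_cast hl.ne'
  obtain ⟨G, hG, h⟩ := exists_memLp_integral_cos_sin_eq hl (a := fun n => c n.natAbs / (2 * l)) (by
    have : Summable fun k : ℕ => ‖c k / (2 * l)‖ ^ 2 := by
      simpa only [norm_div, div_pow] using hc.div_const (‖(2 * l : ℂ)‖ ^ 2)
    refine summable_int_iff_summable_nat_and_neg.2 ⟨?_, ?_⟩ <;> simpa using this)
  refine ⟨_, memLp_fold hl 1 hG, fun k => ?_⟩
  rw [integral_fold_mul hl hG (E := fun x => (Real.cos (Real.pi * k / l * x) : ℂ))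
    (by fun_prop) (by simp), (h k).1]
  simp
  field_simp
  ring

/-- **Riesz–Fischer** for the sine system. -/
theorem exists_memLp_integral_sin_eq {l : ℝ} (hl : 0 < l) {c : ℕ → ℂ}
    (hc : Summable fun k => ‖c k‖ ^ 2) :
    ∃ g : ℝ → ℂ, MemLp g 2 (volume.restrict (Ioo 0 l)) ∧
      ∀ k : ℕ, 1 ≤ k →
        ∫ x in (0 : ℝ)..l, g x * (Real.sin (Real.pi * k / l * x) : ℂ) = c k := by
  have hl' : (l : ℂ) ≠ 0 := by exact_mod_cast hl.ne'
  obtain ⟨G, hG, h⟩ := exists_memLp_integral_cos_sin_eq hl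
    (a := fun n => -Complex.I * n.sign * c n.natAbs / (2 * l)) (by
    have h1 : Summable fun k : ℕ => ‖c k / (2 * l)‖ ^ 2 := by
      simpa only [norm_div, div_pow] using hc.div_const (‖(2 * l : ℂ)‖ ^ 2)
    have h2 : ∀ n : ℤ, ‖((n.sign : ℤ) : ℂ)‖ ≤ 1 := fun n => by
      rcases n.sign_trichotomy with h | h | h <;> simp [h]
    refine summable_int_iff_summable_nat_and_neg.2 ⟨?_, ?_⟩ <;>
    · refine Summable.of_nonneg_of_le (fun k => by positivity) (fun k => ?_) h1
      gcongr ?_ ^ 2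
      rw [mul_div_assoc, norm_mul, norm_mul, norm_neg, Complex.norm_I, one_mul]
      simpa using mul_le_of_le_one_left (norm_nonneg (c k / (2 * l))) (h2 _))
  refine ⟨_, memLp_fold hl (-1) hG, fun k hk => ?_⟩
  rw [integral_fold_mul hl hG (E := fun x => (Real.sin (Real.pi * k / l * x) : ℂ))
    (by fun_prop) (by simp), (h k).2]
  have hk' : ((k : ℤ)).sign = 1 := Int.sign_eq_one_of_pos (by exact_mod_cast hk)
  simp only [Int.sign_neg, hk', Int.natAbs_neg, Int.natAbs_natCast]
  field_simp
  push_cast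
  linear_combination (-2 * c k) * Complex.I_sq

/-! ### Square-summable sequences -/

theorem memℓp_two_iff {a : ℕ → ℂ} : Memℓp a 2 ↔ Summable fun k => ‖a k‖ ^ 2 := by
  rw [memℓp_gen_iff (by norm_num)]
  simp

theorem memℓp_of_isBigO {a b : ℕ → ℂ} (h : a =O[atTop] b) (hb : Memℓp b 2) : Memℓp a 2 := by
  rw [memℓp_two_iff] at hb ⊢
  refine summable_of_isBigO_nat hb ?_
  simpa using (h.norm_norm.pow 2).norm_left

theorem memℓp_of_isBigO_inv {a : ℕ → ℂ} (h : a =O[atTop] fun k : ℕ => (k : ℝ)⁻¹) :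
    Memℓp a 2 := by
  rw [memℓp_two_iff]
  refine summable_of_isBigO_nat (Real.summable_nat_pow_inv.2 one_lt_two) ?_
  simpa using (h.norm_norm.pow 2).norm_left

theorem memℓp_mul_of_isBigO_one {a c : ℕ → ℂ} (hc : c =O[atTop] fun _ => (1 : ℝ))
    (ha : Memℓp a 2) : Memℓp (fun k => c k * a k) 2 := by
  refine memℓp_of_isBigO ?_ ha
  simpa using hc.mul (isBigO_refl (fun k => ‖a k‖) atTop).of_norm_left

theorem tendsto_zero_of_memℓp {a : ℕ → ℂ} (ha : Memℓp a 2) : Tendsto a atTop (𝓝 0) := by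
  have := (memℓp_two_iff.1 ha).tendsto_atTop_zero
  rw [tendsto_zero_iff_norm_tendsto_zero]
  have h2 := this.sqrt
  simpa [Real.sqrt_sq] using h2

theorem memℓp_shift_iff {a : ℕ → ℂ} : Memℓp (fun k => a (k + 1)) 2 ↔ Memℓp a 2 := by
  rw [memℓp_two_iff, memℓp_two_iff]
  exact summable_nat_add_iff (f := fun k => ‖a k‖ ^ 2) 1

theorem memℓp_ofReal {r : ℕ → ℝ} (h : r =O[atTop] fun k : ℕ => (k : ℝ)⁻¹) :
    Memℓp (fun k => (r k : ℂ)) 2 :=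
  memℓp_of_isBigO_inv (IsBigO.of_norm_left (by simpa using h.norm_left))

theorem memℓp_const_mul (c : ℂ) {a : ℕ → ℂ} (ha : Memℓp a 2) : Memℓp (fun k => c * a k) 2 :=
  memℓp_mul_of_isBigO_one (isBigO_const_const c one_ne_zero atTop) ha

/-! ### Asymptotics of the zeros -/

/-- The left end point of the `k`-th interval is at least half its centre. -/
theorem IsZeroChoice.pi_mul_div_le {d l : ℝ} (hl : 0 < l) {z : ℕ → ℝ} (hz : IsZeroChoice d l z) {k : ℕ}
    (hk : 1 ≤ k) : Real.pi * k / (2 * l) ≤ z k := by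
  refine le_trans ?_ (hz k hk).1.1.le
  have hk' : (1 : ℝ) ≤ k := by exact_mod_cast hk
  rw [div_sub_div _ _ hl.ne' (by positivity), div_le_div_iff₀ (by positivity) (by positivity)]
  have : 0 ≤ Real.pi * l * l * (k - 1) := by
    have := Real.pi_pos
    have : 0 ≤ (k : ℝ) - 1 := by linarith
    positivity
  nlinarith

theorem IsZeroChoice.ne_zero {d l : ℝ} (hl : 0 < l) {z : ℕ → ℝ} (hz : IsZeroChoice d l z) {k : ℕ}
    (hk : 1 ≤ k) : z k ≠ 0 := by
  have hk' : (0 : ℝ) < k := by exact_mod_cast hk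
  have : 0 < Real.pi * k / (2 * l) := by positivity
  exact (this.trans_le (hz.pi_mul_div_le hl hk)).ne'

/-- The phases `δ k = z k * l - π k` lie in `(-π/2, π/2)` and satisfy `tan δ = d z / (d² z² - 1)`,
here in a form free of denominators. -/
theorem IsZeroChoice.phase {d l : ℝ} (hl : 0 < l) {z : ℕ → ℝ} (hz : IsZeroChoice d l z) {k : ℕ}
    (hk : 1 ≤ k) :
    |z k * l - Real.pi * k| < Real.pi / 2 ∧
    Real.sin (z k * l) = (-1) ^ k * Real.sin (z k * l - Real.pi * k) ∧
    Real.cos (z k * l) = (-1) ^ k * Real.cos (z k * l - Real.pi * k) ∧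
    (d ^ 2 * z k ^ 2 - 1) * Real.sin (z k * l - Real.pi * k) =
      d * z k * Real.cos (z k * l - Real.pi * k) := by
  obtain ⟨⟨h1, h2⟩, h3⟩ := hz k hk
  have hz0 := hz.ne_zero hl hk
  set δ := z k * l - Real.pi * k with hδ
  have e : z k * l = δ + k * Real.pi := by rw [hδ]; ring
  have hs : Real.sin (z k * l) = (-1) ^ k * Real.sin δ := by rw [e, Real.sin_add_nat_mul_pi]
  have hc : Real.cos (z k * l) = (-1) ^ k * Real.cos δ := by rw [e, Real.cos_add_nat_mul_pi]
  refine ⟨?_, hs, hc, ?_⟩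
  · have e1 : (Real.pi * k / l - Real.pi / (2 * l)) * l = Real.pi * k - Real.pi / 2 := by
      field_simp
    have e2 : (Real.pi * k / l + Real.pi / (2 * l)) * l = Real.pi * k + Real.pi / 2 := by
      field_simp
    have h1' := mul_lt_mul_of_pos_right h1 hl
    have h2' := mul_lt_mul_of_pos_right h2 hl
    rw [abs_lt]
    constructor <;> linarith
  · rw [c₂, hs, hc] at h3
    have hne : ((-1 : ℝ)) ^ k ≠ 0 := pow_ne_zero _ (by norm_num)
    have : (-1 : ℝ) ^ k * (d * z k * Real.cos δ - (d ^ 2 * z k ^ 2 - 1) * Real.sin δ) = 0 := by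
      field_simp at h3
      linear_combination h3
    linarith [(mul_eq_zero.1 this).resolve_left hne]

/-- The phases are `O(1/k)`: for large `k` the equation of the phase gives
`d z |sin δ| ≤ 2`, while `z` grows linearly and `|sin δ| ≥ (2/π) |δ|` on `[-π/2, π/2]`. -/
theorem IsZeroChoice.phase_isBigO {d l : ℝ} (hd : 0 < d) (hl : 0 < l) {z : ℕ → ℝ}
    (hz : IsZeroChoice d l z) :
    (fun k : ℕ => z k * l - Real.pi * k) =O[atTop] fun k : ℕ => (k : ℝ)⁻¹ := by
  refine IsBigO.of_bound (2 * l / d) ?_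
  have hlarge : ∀ᶠ k : ℕ in atTop, 4 * l / (d * Real.pi) ≤ (k : ℝ) :=
    tendsto_natCast_atTop_atTop.eventually_ge_atTop _
  filter_upwards [hlarge, eventually_ge_atTop 1] with k hk hk1
  have hkpos : (0 : ℝ) < k := by exact_mod_cast hk1
  have hzk := hz.pi_mul_div_le hl hk1
  have hpos : 0 < z k := lt_of_lt_of_le (by positivity) hzk
  obtain ⟨hδ, -, -, heq⟩ := hz.phase hl hk1
  set δ := z k * l - Real.pi * k
  have hdz : 2 ≤ d * z k := by
    rw [div_le_iff₀ (by positivity)] at hk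
    have := mul_le_mul_of_nonneg_left hzk hd.le
    refine le_trans ?_ this
    rw [← mul_div_assoc, le_div_iff₀ (by positivity)]
    linarith
  have h1 : 2 / Real.pi * |δ| ≤ |Real.sin δ| := Real.mul_abs_le_abs_sin hδ.le
  have h2 : (d ^ 2 * z k ^ 2 - 1) * |Real.sin δ| ≤ d * z k := by
    have hp : 0 ≤ d ^ 2 * z k ^ 2 - 1 := by nlinarith
    rw [← abs_of_nonneg hp, ← abs_mul, heq, abs_mul, abs_of_pos (mul_pos hd hpos)]
    exact mul_le_of_le_one_right (by positivity) (Real.abs_cos_le_one δ)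
  have h3 : d * z k * |Real.sin δ| ≤ 2 := by
    have h4 : (d * z k) * (d * z k * |Real.sin δ|) ≤ (d * z k) * 2 := by
      nlinarith [abs_nonneg (Real.sin δ), mul_nonneg (abs_nonneg (Real.sin δ))
        (show 0 ≤ d ^ 2 * z k ^ 2 - 2 by nlinarith)]
    exact le_of_mul_le_mul_left h4 (by positivity)
  have h5 : d * (Real.pi * k / (2 * l)) * (2 / Real.pi * |δ|) ≤ 2 := by
    refine le_trans ?_ h3
    gcongr
  rw [Real.norm_eq_abs, Real.norm_eq_abs, abs_of_pos (inv_pos.2 hkpos), ← div_eq_mul_inv,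
    le_div_iff₀ hkpos, le_div_iff₀ hd]
  have : d * (Real.pi * k / (2 * l)) * (2 / Real.pi * |δ|) = |δ| * k * d / l := by
    field_simp
  rw [this, div_le_iff₀ hl] at h5
  exact h5

theorem IsZeroChoice.sub_isBigO {d l : ℝ} (hd : 0 < d) (hl : 0 < l) {z : ℕ → ℝ}
    (hz : IsZeroChoice d l z) :
    (fun k : ℕ => z k - Real.pi * k / l) =O[atTop] fun k : ℕ => (k : ℝ)⁻¹ := by
  refine ((hz.phase_isBigO hd hl).const_mul_left l⁻¹).congr_left fun k => ?_
  field_simp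

theorem abs_cos_sub_one_le_abs (x : ℝ) : |Real.cos x - 1| ≤ |x| := by
  simpa using Real.abs_cos_sub_cos_le x 0

/-- `cos (z_k l) = (-1)ᵏ + O(1/k)`. -/
theorem IsZeroChoice.cos_isBigO {d l : ℝ} (hd : 0 < d) (hl : 0 < l) {z : ℕ → ℝ}
    (hz : IsZeroChoice d l z) :
    (fun k : ℕ => Real.cos (z k * l) - (-1) ^ k) =O[atTop] fun k : ℕ => (k : ℝ)⁻¹ := by
  refine IsBigO.trans (IsBigO.of_bound 1 ?_) (hz.phase_isBigO hd hl)
  filter_upwards [eventually_ge_atTop 1] with k hk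
  rw [(hz.phase hl hk).2.2.1, ← mul_sub_one, norm_mul, norm_pow, norm_neg, norm_one, one_pow]
  simpa using abs_cos_sub_one_le_abs _

/-- `z_k sin (z_k l) = (-1)ᵏ / d + O(1/k)`: this produces the term `u l / d` in `v₂`. -/
theorem IsZeroChoice.mul_sin_isBigO {d l : ℝ} (hd : 0 < d) (hl : 0 < l) {z : ℕ → ℝ}
    (hz : IsZeroChoice d l z) :
    (fun k : ℕ => z k * Real.sin (z k * l) - (-1) ^ k / d) =O[atTop] fun k : ℕ => (k : ℝ)⁻¹ := by
  refine IsBigO.trans (IsBigO.of_bound (2 * l / (Real.pi * d ^ 2) + 1 / d) ?_)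
    (hz.phase_isBigO hd hl)
  filter_upwards [eventually_ge_atTop 1] with k hk
  have hk1 : (1 : ℝ) ≤ k := by exact_mod_cast hk
  obtain ⟨-, hs, -, heq⟩ := hz.phase hl hk
  have hz0 := hz.ne_zero hl hk
  have hzk : Real.pi / (2 * l) ≤ z k := by
    refine le_trans ?_ (hz.pi_mul_div_le hl hk)
    have := Real.pi_pos
    gcongr
    nlinarith
  rw [hs]
  set δ := z k * l - Real.pi * k
  -- Dividing the equation of the phase by `d² z` isolates the leading term `cos δ / d`.
  have e : z k * ((-1) ^ k * Real.sin δ) - (-1) ^ k / d =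
      (-1) ^ k * (Real.sin δ / (d ^ 2 * z k) + (Real.cos δ - 1) / d) := by
    have : z k * Real.sin δ = Real.sin δ / (d ^ 2 * z k) + Real.cos δ / d := by
      field_simp
      linear_combination heq
    linear_combination (-1) ^ k * this
  have h1 : |Real.sin δ / (d ^ 2 * z k)| ≤ 2 * l / (Real.pi * d ^ 2) * |δ| := by
    have hpi : 0 < Real.pi / (2 * l) := by positivity
    have hzp : 0 < z k := hpi.trans_le hzk
    rw [abs_div, abs_of_pos (show 0 < d ^ 2 * z k by positivity)]
    calc |Real.sin δ| / (d ^ 2 * z k) ≤ |δ| / (d ^ 2 * (Real.pi / (2 * l))) := by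
          have := Real.abs_sin_le_abs (x := δ)
          gcongr
      _ = 2 * l / (Real.pi * d ^ 2) * |δ| := by field_simp
  have h2 : |(Real.cos δ - 1) / d| ≤ 1 / d * |δ| := by
    rw [abs_div, abs_of_pos hd, one_div, div_eq_inv_mul]
    exact mul_le_mul_of_nonneg_left (abs_cos_sub_one_le_abs δ) (inv_nonneg.2 hd.le)
  rw [e, norm_mul, norm_pow, norm_neg, norm_one, one_pow, one_mul, Real.norm_eq_abs,
    Real.norm_eq_abs, add_mul]
  exact (abs_add_le _ _).trans (add_le_add h1 h2)

/-! ### Perturbing the frequencies -/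

/-- Replacing the frequency `π k / l` by a frequency `z_k = π k / l + O(1/k)` changes the
coefficients of an `L₂` function `h` by `1/k` times a square-summable sequence. To first order the
change is `(z_k - π k / l)` times the coefficient of `x h(x)` with respect to `C = S'`, to which
Bessel's inequality `hB` applies; the remainder is `O(1/k²)`. -/
theorem memℓp_mul_integral_sub {l : ℝ} (hl : 0 < l) {z : ℕ → ℝ}
    (hz : (fun k : ℕ => z k - Real.pi * k / l) =O[atTop] fun k : ℕ => (k : ℝ)⁻¹)
    {S C : ℝ → ℝ} (hS : Continuous S) (hC : Continuous C)
    (hSC : ∀ a t, |S (a + t) - S a - t * C a| ≤ t ^ 2)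
    (hB : ∀ h : ℝ → ℂ, MemLp h 2 (volume.restrict (Ioo 0 l)) →
      Memℓp (fun k : ℕ => ∫ x in (0 : ℝ)..l, h x * (C (Real.pi * k / l * x) : ℂ)) 2)
    {h : ℝ → ℂ} (hh : MemLp h 2 (volume.restrict (Ioo 0 l))) :
    Memℓp (fun k : ℕ => (k : ℂ) * ((∫ x in (0 : ℝ)..l, h x * (S (z k * x) : ℂ)) -
      ∫ x in (0 : ℝ)..l, h x * (S (Real.pi * k / l * x) : ℂ))) 2 := by
  have hi := intervalIntegrable_of_memLp hl hh
  have hxh : MemLp (fun x : ℝ => (x : ℂ) * h x) 2 (volume.restrict (Ioo 0 l)) := by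
    refine MemLp.of_le_mul (c := l) hh ?_ ?_
    · exact (by fun_prop : Continuous fun x : ℝ => (x : ℂ)).aestronglyMeasurable.mul hh.1
    · filter_upwards [ae_restrict_mem measurableSet_Ioo] with x hx
      rw [norm_mul, Complex.norm_real, Real.norm_eq_abs, abs_of_pos hx.1]
      gcongr
      exact hx.2.le
  set ω : ℕ → ℝ := fun k => Real.pi * k / l with hω
  set ε : ℕ → ℝ := fun k => z k - ω k with hε
  set M : ℝ := ∫ x in (0 : ℝ)..l, ‖h x‖ with hM
  -- the first-order term of the Taylor expansion in the frequency
  have hlin : Memℓp (fun k : ℕ => ((k : ℂ) * (ε k : ℂ)) *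
      ∫ x in (0 : ℝ)..l, ((x : ℂ) * h x) * (C (ω k * x) : ℂ)) 2 := by
    refine memℓp_mul_of_isBigO_one ?_ (hB _ hxh)
    refine IsBigO.trans (g := fun k : ℕ => (k : ℝ) * (k : ℝ)⁻¹) ?_ ?_
    · refine IsBigO.mul ?_ ?_
      · exact IsBigO.of_bound 1 (by simp)
      · exact IsBigO.of_norm_left (by simpa using hz.norm_left)
    · refine IsBigO.of_bound 1 (Eventually.of_forall fun k => ?_)
      rcases Nat.eq_zero_or_pos k with rfl | hk
      · simp
      · have : (k : ℝ) ≠ 0 := by positivity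
        simp [this]
  -- the remainder
  have hrem : Memℓp (fun k : ℕ => (k : ℂ) * ∫ x in (0 : ℝ)..l,
      h x * ((S (z k * x) - S (ω k * x) - ε k * x * C (ω k * x) : ℝ) : ℂ)) 2 := by
    refine memℓp_of_isBigO_inv ?_
    have hbound : (fun k : ℕ => (k : ℂ) * ∫ x in (0 : ℝ)..l,
        h x * ((S (z k * x) - S (ω k * x) - ε k * x * C (ω k * x) : ℝ) : ℂ)) =O[atTop]
        fun k : ℕ => (k : ℝ) * (ε k ^ 2) := by
      refine IsBigO.of_bound (l ^ 2 * M) (Eventually.of_forall fun k => ?_)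
      have hb : ‖∫ x in (0 : ℝ)..l,
          h x * ((S (z k * x) - S (ω k * x) - ε k * x * C (ω k * x) : ℝ) : ℂ)‖ ≤
          ∫ x in (0 : ℝ)..l, ‖h x‖ * (ε k ^ 2 * l ^ 2) := by
        refine intervalIntegral.norm_integral_le_of_norm_le hl.le ?_ (hi.norm.mul_const _)
        refine Eventually.of_forall fun x hx => ?_
        rw [norm_mul, Complex.norm_real, Real.norm_eq_abs]
        gcongr
        have := hSC (ω k * x) (ε k * x)
        rw [← add_mul, show ω k + ε k = z k by simp [hε]] at this
        refine this.trans ?_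
        rw [mul_pow]
        have h0 := hx.1.le
        have h1 := hx.2
        gcongr
      rw [intervalIntegral.integral_mul_const] at hb
      rw [norm_mul, norm_mul, Complex.norm_natCast, Real.norm_natCast, norm_pow,
        Real.norm_eq_abs, sq_abs]
      calc (k : ℝ) * _ ≤ k * (M * (ε k ^ 2 * l ^ 2)) := by gcongr
        _ = _ := by ring
    refine hbound.trans ?_
    refine ((isBigO_refl (fun k : ℕ => (k : ℝ)) atTop).mul (hz.pow 2)).trans ?_
    refine IsBigO.of_bound 1 (Eventually.of_forall fun k => ?_)
    rcases Nat.eq_zero_or_pos k with rfl | hk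
    · simp
    · have : (k : ℝ) ≠ 0 := by positivity
      rw [show (k : ℝ) * (k : ℝ)⁻¹ ^ 2 = (k : ℝ)⁻¹ by field_simp, one_mul]
  convert hlin.add hrem using 1
  funext k
  have i0 : IntervalIntegrable (fun x => (x : ℂ) * h x) volume 0 l :=
    intervalIntegrable_of_memLp hl hxh
  have e : ∫ x in (0 : ℝ)..l,
      h x * ((S (z k * x) - S (ω k * x) - ε k * x * C (ω k * x) : ℝ) : ℂ) =
      (∫ x in (0 : ℝ)..l, h x * (S (z k * x) : ℂ)) - (∫ x in (0 : ℝ)..l, h x * (S (ω k * x) : ℂ)) -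
        ε k * ∫ x in (0 : ℝ)..l, ((x : ℂ) * h x) * (C (ω k * x) : ℂ) := by
    rw [← intervalIntegral.integral_const_mul, ← intervalIntegral.integral_sub
      (hi.mul_continuousOn (by fun_prop)) (hi.mul_continuousOn (by fun_prop)),
      ← intervalIntegral.integral_sub ((hi.mul_continuousOn (by fun_prop)).sub
        (hi.mul_continuousOn (by fun_prop))) ((i0.mul_continuousOn (by fun_prop)).const_mul _)]
    refine intervalIntegral.integral_congr fun x _ => ?_
    push_cast
    ring
  simp only [Pi.add_apply, e]
  ring

theorem abs_add_sub_sub_mul_le_sq {S C : ℝ → ℝ} (hS : ∀ y, HasDerivAt S (C y) y)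
    (hC : ∀ y a, |C y - C a| ≤ |y - a|) (a t : ℝ) :
    |S (a + t) - S a - t * C a| ≤ t ^ 2 := by
  have h := Convex.norm_image_sub_le_of_norm_hasDerivWithin_le (𝕜 := ℝ)
    (f := fun y => S y - y * C a) (f' := fun y => C y - C a) (s := uIcc a (a + t)) (C := |t|)
    (x := a) (y := a + t)
    (fun y _ => ((hS y).sub (hasDerivAt_mul_const (C a))).hasDerivWithinAt)
    (fun y hy => (hC y a).trans (by simpa using abs_sub_left_of_mem_uIcc hy))
    (convex_uIcc a (a + t)) left_mem_uIcc right_mem_uIcc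
  rw [Real.norm_eq_abs, Real.norm_eq_abs, add_sub_cancel_left, abs_mul_abs_self, ← sq] at h
  convert h using 2
  ring

theorem memℓp_mul_integral_cos_sub {l : ℝ} (hl : 0 < l) {z : ℕ → ℝ}
    (hz : (fun k : ℕ => z k - Real.pi * k / l) =O[atTop] fun k : ℕ => (k : ℝ)⁻¹)
    {h : ℝ → ℂ} (hh : MemLp h 2 (volume.restrict (Ioo 0 l))) :
    Memℓp (fun k : ℕ => (k : ℂ) * ((∫ x in (0 : ℝ)..l, h x * (Real.cos (z k * x) : ℂ)) -
      ∫ x in (0 : ℝ)..l, h x * (Real.cos (Real.pi * k / l * x) : ℂ))) 2 := by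
  refine memℓp_mul_integral_sub hl hz Real.continuous_cos Real.continuous_sin.neg
    (abs_add_sub_sub_mul_le_sq Real.hasDerivAt_cos fun y a => ?_) (fun g hg => ?_) hh
  · rw [Pi.neg_apply, Pi.neg_apply, neg_sub_neg, abs_sub_comm]
    exact Real.abs_sin_sub_sin_le y a
  refine memℓp_of_isBigO ?_ (memℓp_two_iff.2 (summable_sq_integral_sin hl hg))
  refine IsBigO.of_bound 1 (Eventually.of_forall fun k => ?_)
  simp [intervalIntegral.integral_neg]

theorem memℓp_mul_integral_sin_sub {l : ℝ} (hl : 0 < l) {z : ℕ → ℝ}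
    (hz : (fun k : ℕ => z k - Real.pi * k / l) =O[atTop] fun k : ℕ => (k : ℝ)⁻¹)
    {h : ℝ → ℂ} (hh : MemLp h 2 (volume.restrict (Ioo 0 l))) :
    Memℓp (fun k : ℕ => (k : ℂ) * ((∫ x in (0 : ℝ)..l, h x * (Real.sin (z k * x) : ℂ)) -
      ∫ x in (0 : ℝ)..l, h x * (Real.sin (Real.pi * k / l * x) : ℂ))) 2 :=
  memℓp_mul_integral_sub hl hz Real.continuous_sin Real.continuous_cos
    (abs_add_sub_sub_mul_le_sq Real.hasDerivAt_sin Real.abs_cos_sub_cos_le)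
    (fun _ hg => memℓp_two_iff.2 (summable_sq_integral_cos hl hg)) hh

/-- **Bessel's inequality**, in qualitative form, for the cosines with perturbed frequencies. -/
theorem memℓp_integral_cos {l : ℝ} (hl : 0 < l) {z : ℕ → ℝ}
    (hz : (fun k : ℕ => z k - Real.pi * k / l) =O[atTop] fun k : ℕ => (k : ℝ)⁻¹)
    {h : ℝ → ℂ} (hh : MemLp h 2 (volume.restrict (Ioo 0 l))) :
    Memℓp (fun k : ℕ => ∫ x in (0 : ℝ)..l, h x * (Real.cos (z k * x) : ℂ)) 2 := by
  have h1 := memℓp_two_iff.2 (summable_sq_integral_cos hl hh)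
  have h2 : Memℓp (fun k : ℕ => (∫ x in (0 : ℝ)..l, h x * (Real.cos (z k * x) : ℂ)) -
      ∫ x in (0 : ℝ)..l, h x * (Real.cos (Real.pi * k / l * x) : ℂ)) 2 := by
    refine memℓp_of_isBigO (IsBigO.of_bound 1 ?_) (memℓp_mul_integral_cos_sub hl hz hh)
    filter_upwards [eventually_ge_atTop 1] with k hk
    rw [one_mul, norm_mul, Complex.norm_natCast]
    exact le_mul_of_one_le_left (norm_nonneg _) (by exact_mod_cast hk)
  convert h2.add h1 using 1
  funext k
  simp

/-! ### Recognizing smoothness from Fourier coefficients -/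

theorem integral_mul_congr {l : ℝ} (hl : 0 < l) {f g : ℝ → ℂ} (φ : ℝ → ℂ)
    (h : f =ᵐ[volume.restrict (Ioo 0 l)] g) :
    ∫ x in (0 : ℝ)..l, f x * φ x = ∫ x in (0 : ℝ)..l, g x * φ x := by
  refine intervalIntegral.integral_congr_ae_restrict ?_
  rw [uIoc_of_le hl.le, ← restrict_Ioo_eq_restrict_Ioc]
  filter_upwards [h] with x hx
  rw [hx]

/-- An `L₂` function whose cosine coefficients are `1/k` times a square-summable sequence has a
`W¹₂` representative: the sine series with coefficients `-(π k / l) a_k` converges to its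
derivative. -/
theorem exists_isW12_of_cos {l : ℝ} (hl : 0 < l) {f : ℝ → ℂ}
    (hf : MemLp f 2 (volume.restrict (Ioo 0 l)))
    (h : Memℓp (fun k : ℕ => (k : ℂ) *
      ∫ x in (0 : ℝ)..l, f x * (Real.cos (Real.pi * k / l * x) : ℂ)) 2) :
    ∃ F g : ℝ → ℂ, IsW12 l F g ∧ f =ᵐ[volume.restrict (Ioo 0 l)] F := by
  have hl' : (l : ℂ) ≠ 0 := by exact_mod_cast hl.ne'
  obtain ⟨g, hg, hgk⟩ := exists_memLp_integral_sin_eq hl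
    (memℓp_two_iff.1 (memℓp_const_mul (-(Real.pi / l : ℂ)) h))
  -- The constant of integration is fixed by the mean value of `f`.
  set P : ℝ → ℂ := fun x => ∫ t in (0 : ℝ)..x, g t with hP
  set C : ℂ := ((∫ x in (0 : ℝ)..l, f x) - ∫ x in (0 : ℝ)..l, P x) / l with hC
  have hF : IsW12 l (fun x => C + P x) g := isW12_primitive hl hg C
  have hFc := hF.absolutelyContinuous.continuousOn
  have hF2 : MemLp (fun x => C + P x) 2 (volume.restrict (Ioo 0 l)) :=
    memLp_of_continuousOn (by simpa [uIcc_of_le hl.le] using hFc)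
  refine ⟨_, g, hF, ?_⟩
  have hi := intervalIntegrable_of_memLp hl hf
  have hFi := intervalIntegrable_of_memLp hl hF2
  have key := ae_eq_zero_of_integral_cos hl (hf.sub hF2) fun k => ?_
  · filter_upwards [key] with x hx
    exact sub_eq_zero.1 hx
  have e : ∫ x in (0 : ℝ)..l, (f - fun x => C + P x) x * (Real.cos (Real.pi * k / l * x) : ℂ) =
      (∫ x in (0 : ℝ)..l, f x * (Real.cos (Real.pi * k / l * x) : ℂ)) -
      ∫ x in (0 : ℝ)..l, (C + P x) * (Real.cos (Real.pi * k / l * x) : ℂ) := by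
    rw [← intervalIntegral.integral_sub (hi.mul_continuousOn (by fun_prop))
      (hFi.mul_continuousOn (by fun_prop))]
    simp only [Pi.sub_apply, sub_mul]
  rw [e]
  rcases Nat.eq_zero_or_pos k with rfl | hk
  · have hPi : IntervalIntegrable P volume 0 l := by
      simpa using hFi.sub (intervalIntegrable_const (c := C))
    simp only [Nat.cast_zero, mul_zero, zero_div, zero_mul, Real.cos_zero, Complex.ofReal_one,
      mul_one]
    rw [intervalIntegral.integral_add intervalIntegrable_const hPi,
      intervalIntegral.integral_const, sub_zero, Complex.real_smul, hC]
    field_simp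
    ring
  · have hk0 : (k : ℂ) ≠ 0 := by exact_mod_cast hk.ne'
    have hpi : (Real.pi : ℂ) ≠ 0 := by exact_mod_cast Real.pi_ne_zero
    have h1 := hF.mul_integral_cos hl (Real.pi * k / l)
    rw [hgk k hk, show Real.pi * k / l * l = k * Real.pi by field_simp, Real.sin_nat_mul_pi] at h1
    have h2 : ((Real.pi * k / l : ℝ) : ℂ) *
        ((∫ x in (0 : ℝ)..l, f x * (Real.cos (Real.pi * k / l * x) : ℂ)) -
        ∫ x in (0 : ℝ)..l, (C + P x) * (Real.cos (Real.pi * k / l * x) : ℂ)) = 0 := by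
      rw [mul_sub, h1]
      push_cast
      ring
    refine (mul_eq_zero.1 h2).resolve_left ?_
    push_cast
    positivity

/-- If the sine coefficients `s_k` of an `L₂` function satisfy
`(π k / l) s_k = B - A (-1)ᵏ + r_k` with `r` square-summable, it has a `W¹₂` representative.
The numbers `B` and `A` are the boundary values of the representative at `0` and `l`. -/
theorem exists_isW12_of_sin {l : ℝ} (hl : 0 < l) {g : ℝ → ℂ}
    (hg : MemLp g 2 (volume.restrict (Ioo 0 l))) (A B : ℂ)
    (h : Memℓp (fun k : ℕ => ((Real.pi * k / l : ℝ) : ℂ) *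
      (∫ x in (0 : ℝ)..l, g x * (Real.sin (Real.pi * k / l * x) : ℂ)) - (B - A * (-1) ^ k)) 2) :
    ∃ φ q : ℝ → ℂ, IsW12 l φ q ∧ g =ᵐ[volume.restrict (Ioo 0 l)] φ := by
  obtain ⟨q, hq, hqk⟩ := exists_memLp_integral_cos_eq hl (memℓp_two_iff.1 h)
  set φ : ℝ → ℂ := fun x => B + ∫ t in (0 : ℝ)..x, q t with hφdef
  have hφ : IsW12 l φ q := isW12_primitive hl hq B
  have hφ2 : MemLp φ 2 (volume.restrict (Ioo 0 l)) :=
    memLp_of_continuousOn (by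
      simpa [uIcc_of_le hl.le] using hφ.absolutelyContinuous.continuousOn)
  have hφ0 : φ 0 = B := by simp [hφdef]
  -- The coefficient with `k = 0` is the mean of `q`, that is, `φ l - φ 0 = A - B`.
  have hφl : φ l = A := by
    have := hqk 0
    simp at this
    simp [hφdef, this]
  refine ⟨φ, q, hφ, ?_⟩
  have hi := intervalIntegrable_of_memLp hl hg
  have hφi := intervalIntegrable_of_memLp hl hφ2
  have key := ae_eq_zero_of_integral_sin hl (hg.sub hφ2) fun k hk => ?_
  · filter_upwards [key] with x hx
    exact sub_eq_zero.1 hx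
  have e : ∫ x in (0 : ℝ)..l, (g - φ) x * (Real.sin (Real.pi * k / l * x) : ℂ) =
      (∫ x in (0 : ℝ)..l, g x * (Real.sin (Real.pi * k / l * x) : ℂ)) -
      ∫ x in (0 : ℝ)..l, φ x * (Real.sin (Real.pi * k / l * x) : ℂ) := by
    rw [← intervalIntegral.integral_sub (hi.mul_continuousOn (by fun_prop))
      (hφi.mul_continuousOn (by fun_prop))]
    simp only [Pi.sub_apply, sub_mul]
  rw [e]
  have h1 := hφ.mul_integral_sin hl (Real.pi * k / l)
  rw [hqk k, show Real.pi * k / l * l = k * Real.pi by field_simp, Real.cos_nat_mul_pi, hφ0,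
    hφl] at h1
  have h2 : ((Real.pi * k / l : ℝ) : ℂ) *
      ((∫ x in (0 : ℝ)..l, g x * (Real.sin (Real.pi * k / l * x) : ℂ)) -
      ∫ x in (0 : ℝ)..l, φ x * (Real.sin (Real.pi * k / l * x) : ℂ)) = 0 := by
    rw [mul_sub, h1]
    push_cast
    ring
  refine (mul_eq_zero.1 h2).resolve_left ?_
  have hk' : (0 : ℝ) < k := by exact_mod_cast hk
  exact_mod_cast (show 0 < Real.pi * k / l by positivity).ne'

/-! ### The two directions and uniqueness -/

/-- The asymptotics hold for a `W²₂` function with the asserted values of `v₁` and `v₂`: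
integrate by parts twice and use the asymptotics of `z_k sin (z_k l)` and `cos (z_k l)`. -/
theorem IsW22Rep.exists_cosAsymptotics {d l : ℝ} (hd : 0 < d) (hl : 0 < l) {z : ℕ → ℝ}
    (hz : IsZeroChoice d l z) {f u : ℝ → ℂ} (h : IsW22Rep l f u) :
    ∃ γ, CosAsymptotics l z f (D l u 0) (D l u l + u l / (d : ℂ)) γ := by
  obtain ⟨hu, hfu⟩ := h
  refine ⟨fun k => (z k : ℂ) ^ 2 * (∫ x in (0 : ℝ)..l, f x * (Real.cos (z k * x) : ℂ)) -
    ((-1) ^ k * (D l u l + u l / (d : ℂ)) - D l u 0), ?_, fun k hk => ?_⟩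
  · rw [memℓp_shift_iff (a := fun k => (z k : ℂ) ^ 2 *
      (∫ x in (0 : ℝ)..l, f x * (Real.cos (z k * x) : ℂ)) -
      ((-1) ^ k * (D l u l + u l / (d : ℂ)) - D l u 0))]
    have m1 := memℓp_const_mul (u l) (memℓp_ofReal (hz.mul_sin_isBigO hd hl))
    have m2 := memℓp_const_mul (D l u l) (memℓp_ofReal (hz.cos_isBigO hd hl))
    have m3 := memℓp_integral_cos hl (hz.sub_isBigO hd hl) hu.memLp_deriv2
    convert (m1.add m2).sub m3 using 1
    funext k
    have e1 := (hu.isW12 hl).mul_integral_cos hl (z k)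
    have e2 := (hu.isW12_deriv hl).mul_integral_sin hl (z k)
    rw [integral_mul_congr hl _ hfu]
    simp only [Pi.add_apply, Pi.sub_apply]
    push_cast
    push_cast at e1 e2
    linear_combination (z k : ℂ) * e1 - e2
  · have : (z k : ℂ) ≠ 0 := by exact_mod_cast hz.ne_zero hl hk
    field_simp
    ring

theorem eq_zero_of_alternating_tendsto {a b : ℂ}
    (h : Tendsto (fun k : ℕ => (-1) ^ k * a + b) atTop (𝓝 0)) : a = 0 ∧ b = 0 := by
  have he := h.comp (tendsto_id.const_mul_atTop' (r := 2) two_pos)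
  have ho := h.comp ((tendsto_add_atTop_nat 1).comp
    (tendsto_id.const_mul_atTop' (r := 2) two_pos))
  simp only [Function.comp_def, id, pow_add, pow_mul, even_two, Even.neg_pow, one_pow, one_mul,
    pow_one] at he ho
  have h1 := tendsto_nhds_unique tendsto_const_nhds he
  have h2 := tendsto_nhds_unique tendsto_const_nhds ho
  constructor
  · linear_combination (h1 - h2) / 2
  · linear_combination (h1 + h2) / 2

theorem CosAsymptotics.mul_integral {l : ℝ} {z : ℕ → ℝ} {f : ℝ → ℂ} {v₁ v₂ : ℂ} {γ : ℕ → ℂ}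
    (h : CosAsymptotics l z f v₁ v₂ γ) {k : ℕ} (hk : 1 ≤ k) (hz : z k ≠ 0) :
    (z k : ℂ) ^ 2 * (∫ x in (0 : ℝ)..l, f x * (Real.cos (z k * x) : ℂ)) =
      (-1) ^ k * v₂ - v₁ + γ k := by
  have hz' : (z k : ℂ) ≠ 0 := by exact_mod_cast hz
  rw [h.2 k hk]
  field_simp

theorem CosAsymptotics.unique {d l : ℝ} (hl : 0 < l) {z : ℕ → ℝ} (hz : IsZeroChoice d l z)
    {f : ℝ → ℂ} {v₁ v₂ w₁ w₂ : ℂ} {γ η : ℕ → ℂ} (h : CosAsymptotics l z f v₁ v₂ γ)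
    (h' : CosAsymptotics l z f w₁ w₂ η) : v₁ = w₁ ∧ v₂ = w₂ := by
  have ht := (tendsto_zero_of_memℓp (memℓp_shift_iff.1 h'.1)).sub
    (tendsto_zero_of_memℓp (memℓp_shift_iff.1 h.1))
  rw [sub_zero] at ht
  have := eq_zero_of_alternating_tendsto (a := v₂ - w₂) (b := w₁ - v₁) (by
    refine ht.congr' ?_
    filter_upwards [eventually_ge_atTop 1] with k hk
    have h0 := hz.ne_zero hl hk
    linear_combination h.mul_integral hk h0 - h'.mul_integral hk h0)
  exact ⟨(sub_eq_zero.1 this.2).symm, sub_eq_zero.1 this.1⟩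

/-- The asymptotics give coefficients of order `1/k²`, more than enough for one derivative. -/
theorem CosAsymptotics.memℓp_natCast_mul {d l : ℝ} (hl : 0 < l) {z : ℕ → ℝ}
    (hz : IsZeroChoice d l z) {f : ℝ → ℂ} {v₁ v₂ : ℂ} {γ : ℕ → ℂ}
    (h : CosAsymptotics l z f v₁ v₂ γ) :
    Memℓp (fun k : ℕ => (k : ℂ) * ∫ x in (0 : ℝ)..l, f x * (Real.cos (z k * x) : ℂ)) 2 := by
  have hγ := (tendsto_zero_of_memℓp (memℓp_shift_iff.1 h.1)).isBigO_one ℝ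
  have hm : (fun k : ℕ => (-1) ^ k * v₂ - v₁ + γ k) =O[atTop] fun _ => (1 : ℝ) := by
    refine (IsBigO.sub ?_ (isBigO_const_const _ one_ne_zero _)).add hγ
    exact IsBigO.of_bound ‖v₂‖ (by simp)
  have hzinv : (fun k : ℕ => (z k)⁻¹) =O[atTop] fun k : ℕ => (k : ℝ)⁻¹ := by
    refine IsBigO.of_bound (2 * l / Real.pi) ?_
    filter_upwards [eventually_ge_atTop 1] with k hk
    have hk' : (0 : ℝ) < k := by exact_mod_cast hk
    have hp : 0 < Real.pi * k / (2 * l) := by positivity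
    have hzk := hz.pi_mul_div_le hl hk
    rw [Real.norm_of_nonneg (inv_nonneg.2 (hp.le.trans hzk)),
      Real.norm_of_nonneg (inv_nonneg.2 hk'.le)]
    refine (inv_anti₀ hp hzk).trans_eq ?_
    field_simp
  refine memℓp_of_isBigO_inv ?_
  have h1 : (fun k : ℕ => (k : ℝ) * ((z k)⁻¹ ^ 2 * ‖(-1) ^ k * v₂ - v₁ + γ k‖)) =O[atTop]
      fun k : ℕ => (k : ℝ) * ((k : ℝ)⁻¹ ^ 2 * 1) :=
    (isBigO_refl _ _).mul ((hzinv.pow 2).mul hm.norm_left)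
  refine IsBigO.trans (IsBigO.of_bound 1 ?_) (h1.trans (IsBigO.of_bound 1 ?_))
  · filter_upwards [eventually_ge_atTop 1] with k hk
    rw [h.2 k hk]
    simp
  · filter_upwards [eventually_ge_atTop 1] with k hk
    have hk' : (k : ℝ) ≠ 0 := by positivity
    rw [show (k : ℝ) * ((k : ℝ)⁻¹ ^ 2 * 1) = (k : ℝ)⁻¹ by field_simp, one_mul]

/-- The asymptotics force `f ∈ W²₂[0, l]`. At each of the two steps the frequencies `z_k` are
replaced by `π k / l` at the cost of `1/k` times a square-summable sequence, which gains one
derivative. -/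
theorem CosAsymptotics.memW22 {d l : ℝ} (hd : 0 < d) (hl : 0 < l) {z : ℕ → ℝ}
    (hz : IsZeroChoice d l z) {f : ℝ → ℂ} (hf : MemLp f 2 (volume.restrict (Ioo 0 l)))
    {v₁ v₂ : ℂ} {γ : ℕ → ℂ} (h : CosAsymptotics l z f v₁ v₂ γ) : MemW22 l f := by
  have hε := hz.sub_isBigO hd hl
  -- first bootstrap step: `f` has a square-integrable derivative `g`
  obtain ⟨F, g, hF, hfF⟩ := exists_isW12_of_cos hl hf (by
    convert (h.memℓp_natCast_mul hl hz).sub (memℓp_mul_integral_cos_sub hl hε hf) using 1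
    funext k
    simp only [Pi.sub_apply]
    ring)
  have hgi := intervalIntegrable_of_memLp hl hF.memLp
  -- second bootstrap step: so has `g`
  have hrem : Memℓp (fun k : ℕ => ((z k - Real.pi * k / l : ℝ) : ℂ) *
      ∫ x in (0 : ℝ)..l, g x * (Real.sin (z k * x) : ℂ)) 2 := by
    refine memℓp_of_isBigO_inv ?_
    have hb : (fun k : ℕ => ∫ x in (0 : ℝ)..l, g x * (Real.sin (z k * x) : ℂ)) =O[atTop]
        fun _ => (1 : ℝ) := by
      refine IsBigO.of_bound (∫ x in (0 : ℝ)..l, ‖g x‖) (Eventually.of_forall fun k => ?_)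
      rw [norm_one, mul_one]
      refine intervalIntegral.norm_integral_le_of_norm_le hl.le
        (Eventually.of_forall fun x _ => ?_) hgi.norm
      rw [norm_mul, Complex.norm_real]
      exact mul_le_of_le_one_right (norm_nonneg _) (Real.abs_sin_le_one _)
    have hε' : (fun k : ℕ => ((z k - Real.pi * k / l : ℝ) : ℂ)) =O[atTop]
        fun k : ℕ => (k : ℝ)⁻¹ := by
      refine IsBigO.of_norm_left ?_
      simpa only [Complex.norm_real] using hε.norm_left
    simpa using hε'.mul hb
  have hsin : Memℓp (fun k : ℕ => ((Real.pi * k / l : ℝ) : ℂ) *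
      (∫ x in (0 : ℝ)..l, g x * (Real.sin (Real.pi * k / l * x) : ℂ)) -
        (v₁ - (v₂ - F l / d) * (-1) ^ k)) 2 := by
    have m1 := memℓp_const_mul (F l) (memℓp_ofReal (hz.mul_sin_isBigO hd hl))
    have m2 := memℓp_shift_iff.1 h.1
    have m3 := memℓp_const_mul (Real.pi / l) (memℓp_mul_integral_sin_sub hl hε hF.memLp)
    refine memℓp_of_isBigO (EventuallyEq.isBigO ?_) (((m1.sub m2).sub hrem).sub m3)
    filter_upwards [eventually_ge_atTop 1] with k hk
    have e1 := hF.mul_integral_cos hl (z k)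
    have e2 := h.mul_integral hk (hz.ne_zero hl hk)
    rw [integral_mul_congr hl _ hfF] at e2
    simp only [Pi.sub_apply]
    push_cast
    push_cast at e1 e2
    linear_combination (z k : ℂ) * e1 - e2
  obtain ⟨φ, q, hφ, hgφ⟩ := exists_isW12_of_sin hl hF.memLp _ _ hsin
  refine ⟨F, isW22_of_primitive hl hφ fun x hx => ?_, hfF⟩
  rw [hF.eq_integral hl hx]
  congr 1
  refine intervalIntegral.integral_congr_ae_restrict ?_
  rw [uIoc_of_le hx.1, ← restrict_Ioo_eq_restrict_Ioc]
  exact ae_restrict_of_ae_restrict_of_subset (Ioo_subset_Ioo_right hx.2) hgφ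

end FrozenArg

theorem lemma3 (d l : ℝ) (hd : 0 < d) (hl : 0 < l)
    (z : ℕ → ℝ) (hz : FrozenArg.IsZeroChoice d l z)
    (f : ℝ → ℂ) (hf : MemLp f 2 (volume.restrict (Ioo 0 l))) :
    (FrozenArg.MemW22 l f ↔
      ∃ (v₁ v₂ : ℂ) (γ : ℕ → ℂ), FrozenArg.CosAsymptotics l z f v₁ v₂ γ) ∧
    (∀ (v₁ v₂ : ℂ) (γ : ℕ → ℂ), FrozenArg.CosAsymptotics l z f v₁ v₂ γ →
      ∀ u : ℝ → ℂ, FrozenArg.IsW22Rep l f u →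
        v₁ = FrozenArg.D l u 0 ∧ v₂ = FrozenArg.D l u l + u l / (d : ℂ)) := by
  refine ⟨⟨fun ⟨u, hu⟩ => ⟨_, _, hu.exists_cosAsymptotics hd hl hz⟩,
    fun ⟨_, _, _, h⟩ => h.memW22 hd hl hz hf⟩, fun v₁ v₂ γ h u hu => ?_⟩
  obtain ⟨η, hη⟩ := hu.exists_cosAsymptotics hd hl hz
  exact h.unique hl hz hη
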